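/- All graphs are finite and simple. A \emph{$2$-tree} is a graph that can be obtained from the complete graph $K_2$ by finitely many (possibly zero) applications of the operation: add a new vertex and join it to two adjacent vertices of the existing graph. A \emph{triangle} of a graph is a set $abc=\{a,b,c\}$ of three mutually adjacent vertices. A \emph{perfect $3$-cover} of $G$ is a set $\mathcal P$ of triangles of $G$ such that every vertex of $G$ belongs to exactly one member of $\mathcal P$. Let $\alpha(G)$ be the maximum cardinality of an independent set of $G$, and let $\alpha_c(G)$ be the greatest integer $r$ such that every vertex of $G$ belongs to an independent set of cardinality at least $r$. The graph $G$ is \emph{$\alpha$-excellent} if $\alpha_c(G)=\alpha(G)$, that is, if every vertex of $G$ lies in an independent set of cardinality $\alpha(G)$. Let $\mathcal E$ be the family of $2$-trees whose triangles are labeled red or blue (with $R(G)$ and $B(G)$ the sets of red and of blue triangles of $G$) defined recursively as follows. (1) $\mathcal E$ contains the triangle $K_3$ whose only triangle is red. (2) $\mathcal E$ is closed under the following two operations on a member $G'$ of $\mathcal E$. Operation $\mathcal O_1$: let $v_1v_2$ be an edge of $G'$. Add three new vertices $u_1,u_2,u_3$, joining $u_1$ to $v_1$ and $v_2$, then $u_2$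 to $v_2$ and $u_1$, then $u_3$ to $u_1$ and $u_2$. For the resulting graph $G$ put $R(G)=R(G')\cup\{u_1u_2u_3\}$ and $B(G)=B(G')\cup\{v_1v_2u_1,\,v_2u_1u_2\}$. Operation $\mathcal O_2$: let $v_1v_2v_3\in R(G')$ be a red triangle of $G'$ and let $v_4$ be a neighbor of $v_3$ in $G'$ (possibly $v_4\in\{v_1,v_2\}$). Add three new vertices $u_0,u_1,u_2$, joining $u_0$ to $v_1$ and $v_2$, then $u_1$ to $v_3$ and $v_4$, then $u_2$ to $v_3$ and $u_1$. For the resulting graph $G$ put $R(G)=(R(G')\setminus\{v_1v_2v_3\})\cup\{u_0v_1v_2,\,v_3u_1u_2\}$ and $B(G)=B(G')\cup\{v_1v_2v_3,\,v_3v_4u_1\}$. An unlabeled graph $G$ is said to belong to $\mathcal E$ if its triangles can be labeled so that the resulting labeled graph is a member of $\mathcal E$. \textbf{Theorem.} If $G$ is a $2$-tree of order $n\ge 3$, then the following statements are equivalent: (a) $G$ has a perfect $3$-cover; (b) $G$ belongs to the family $\mathcal E$; (c) $G$ is an $\alpha$-excellent graph. -/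

import Mathlib

namespace TwoTree

/-! A graph "on the vertex set `S`", with `S : Finset V`, is a `SimpleGraph V` all of whose edges
join vertices of `S`; the elements of `V` outside `S` are not regarded as vertices of it. -/

/-- The complete graph on the vertex set `S`. -/
def completeOn {V : Type*} (S : Finset V) : SimpleGraph V :=
  SimpleGraph.fromRel (fun x y => x ∈ S ∧ y ∈ S)

/-- The graph obtained from `G` by joining the (new) vertex `v` to all vertices of `C`. -/
def addVertex {V : Type*} (G : SimpleGraph V) (v : V) (C : Finset V) : SimpleGraph V :=
  G ⊔ SimpleGraph.fromRel (fun x y => x = v ∧ y ∈ C)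

/-- `IsKTreeOn k S G`: the graph `G` on the vertex set `S` can be obtained from a complete graph
on `k` vertices by finitely many applications of the operation: add a new vertex and join it to
`k` mutually adjacent vertices of the existing graph. -/
inductive IsKTreeOn {V : Type*} [DecidableEq V] (k : ℕ) : Finset V → SimpleGraph V → Prop
  | complete (S : Finset V) (hS : S.card = k) : IsKTreeOn k S (completeOn S)
  | add (S : Finset V) (G : SimpleGraph V) (hG : IsKTreeOn k S G) (v : V) (hv : v ∉ S)
      (C : Finset V) (hCS : C ⊆ S) (hC : G.IsNClique k C) :
      IsKTreeOn k (insert v S) (addVertex G v C)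

/-- `G` is a `k`-tree (with vertex set all of `V`). -/
def IsKTree {V : Type*} [Fintype V] [DecidableEq V] (k : ℕ) (G : SimpleGraph V) : Prop :=
  IsKTreeOn k Finset.univ G

/-- `P` is a perfect `m`-cover of `G`: a set of complete subgraphs of order `m` (each given by
its set of vertices) such that every vertex of `G` belongs to exactly one of them. -/
def IsPerfectCover {V : Type*} (G : SimpleGraph V) (m : ℕ) (P : Set (Finset V)) : Prop :=
  (∀ T ∈ P, G.IsNClique m T) ∧ ∀ v : V, ∃! T : Finset V, T ∈ P ∧ v ∈ T

/-- `InFamilyE S G R B`: the graph `G` on the vertex set `S`, with the set `R` of red triangles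
and the set `B` of blue triangles (each triangle given by its set of vertices), is a labeled
`2`-tree of the family `𝓔`. -/
inductive InFamilyE {V : Type*} [DecidableEq V] :
    Finset V → SimpleGraph V → Finset (Finset V) → Finset (Finset V) → Prop
  /-- A single red triangle. -/
  | triangle (T : Finset V) (hT : T.card = 3) : InFamilyE T (completeOn T) {T} ∅
  /-- The operation `O₁(v₁, v₂)`, applied to the edge `v₁v₂`. -/
  | op1 (S : Finset V) (G : SimpleGraph V) (R B : Finset (Finset V)) (hG : InFamilyE S G R B)
      (v₁ v₂ : V) (hv : G.Adj v₁ v₂)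
      (u₁ u₂ u₃ : V) (hu₁ : u₁ ∉ S) (hu₂ : u₂ ∉ S) (hu₃ : u₃ ∉ S)
      (h₁₂ : u₁ ≠ u₂) (h₁₃ : u₁ ≠ u₃) (h₂₃ : u₂ ≠ u₃) :
      InFamilyE (S ∪ {u₁, u₂, u₃})
        (addVertex (addVertex (addVertex G u₁ {v₁, v₂}) u₂ {v₂, u₁}) u₃ {u₁, u₂})
        (R ∪ {{u₁, u₂, u₃}})
        (B ∪ {{v₁, v₂, u₁}, {v₂, u₁, u₂}})
  /-- The operation `O₂(v₁v₂, v₃v₄)`, applied to the edge `v₁v₂` of the red triangle `v₁v₂v₃`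
  and to the edge `v₃v₄`; here `v₄ = v₁` and `v₄ = v₂` are allowed. -/
  | op2 (S : Finset V) (G : SimpleGraph V) (R B : Finset (Finset V)) (hG : InFamilyE S G R B)
      (v₁ v₂ v₃ v₄ : V) (hv₁₂ : G.Adj v₁ v₂) (hv₁₃ : G.Adj v₁ v₃) (hv₂₃ : G.Adj v₂ v₃)
      (hred : {v₁, v₂, v₃} ∈ R) (hv₃₄ : G.Adj v₃ v₄)
      (u₀ u₁ u₂ : V) (hu₀ : u₀ ∉ S) (hu₁ : u₁ ∉ S) (hu₂ : u₂ ∉ S)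
      (h₀₁ : u₀ ≠ u₁) (h₀₂ : u₀ ≠ u₂) (h₁₂ : u₁ ≠ u₂) :
      InFamilyE (S ∪ {u₀, u₁, u₂})
        (addVertex (addVertex (addVertex G u₀ {v₁, v₂}) u₁ {v₃, v₄}) u₂ {v₃, u₁})
        ((R \ {{v₁, v₂, v₃}}) ∪ {{u₀, v₁, v₂}, {v₃, u₁, u₂}})
        (B ∪ {{v₁, v₂, v₃}, {v₃, v₄, u₁}})

/-- `G` belongs to the family `𝓔`: for some labeling of its triangles it is one of the labeled
`2`-trees of `𝓔`. -/
def BelongsToE {V : Type*} [Fintype V] [DecidableEq V] (G : SimpleGraph V) : Prop :=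
  ∃ R B : Finset (Finset V), InFamilyE Finset.univ G R B

/-- The common independence number `α_c(G)`: the greatest `r` such that every vertex of `G`
belongs to some independent set of at least `r` vertices. -/
noncomputable def commonIndepNum {V : Type*} (G : SimpleGraph V) : ℕ :=
  sSup {r : ℕ | ∀ v : V, ∃ X : Finset V, G.IsIndepSet X ∧ v ∈ X ∧ r ≤ X.card}

/-- `G` is `α`-excellent: `α_c(G) = α(G)`. -/
def IsAlphaExcellent {V : Type*} (G : SimpleGraph V) : Prop :=
  commonIndepNum G = G.indepNum

/-- A nonempty finite graph is `α`-excellent if and only if every vertex belongs to some maximum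
independent set. -/
theorem isAlphaExcellent_iff {V : Type*} [Finite V] [Nonempty V] (G : SimpleGraph V) :
    IsAlphaExcellent G ↔ ∀ v : V, ∃ X : Finset V, G.IsMaximumIndepSet X ∧ v ∈ X := by
  have hbdd : BddAbove {r : ℕ | ∀ v : V, ∃ X : Finset V, G.IsIndepSet X ∧ v ∈ X ∧ r ≤ X.card} := by
    refine ⟨G.indepNum, fun r hr => ?_⟩
    obtain ⟨X, hX, -, h⟩ := hr (Classical.arbitrary V)
    exact h.trans hX.card_le_indepNum
  have hne : {r : ℕ | ∀ v : V, ∃ X : Finset V,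
      G.IsIndepSet X ∧ v ∈ X ∧ r ≤ X.card}.Nonempty :=
    ⟨0, fun v => ⟨{v}, by simp [SimpleGraph.IsIndepSet], by simp, by simp⟩⟩
  constructor
  · intro h v
    have hmem := Nat.sSup_mem hne hbdd
    change commonIndepNum G ∈ _ at hmem
    rw [h] at hmem
    obtain ⟨X, hX, hv, hc⟩ := hmem v
    exact ⟨X, ⟨hX, fun t ht => ht.card_le_indepNum.trans hc⟩, hv⟩
  · intro h
    refine le_antisymm ?_ (le_csSup hbdd fun v => ?_)
    · obtain ⟨X, hX, -, hc⟩ := Nat.sSup_mem hne hbdd (Classical.arbitrary V)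
      exact hc.trans hX.card_le_indepNum
    · obtain ⟨X, hX, hv⟩ := h v
      exact ⟨X, hX.isIndepSet, hv, (G.maximumIndepSet_card_eq_indepNum X hX).ge⟩

end TwoTree

namespace TwoTree

/-! ### Covers, colourings and clique covers along the construction of a `k`-tree. -/

section

variable {V : Type*}

/-! From (b) to (a), the red triangles always form a perfect cover: `𝒪₁` adds a disjoint red
triangle, and `𝒪₂` replaces a red triangle by two disjoint ones covering it and the three new
vertices.

From (a) to (c), an independent set meets each triangle of a cover `P` at most once, so `α ≤ |P|`. A
2-tree has a proper 3-colouring, and its three classes have total size `3|P|`, so each has size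
exactly `|P|`. Every vertex thus lies in a maximum independent set, its colour class.

From (c) to (a), a 2-tree has an independent set `I` and a cover by cliques indexed by `I`
(`IsKTreeOn.exists_cliqueCover`). The cliques extend to triangles. A maximum independent set through
`v` meets each triangle exactly once, so `v` lies in only one of them.

From (a) to (b), the stronger claim `Layered.exists_inFamilyE` is that every perfect cover is the
red set of some labeling. Vertices receive depths from a root edge, and near a deepest vertex the
cover is so constrained that one of the two operations can be undone. The rest is a smaller layered
graph with a perfect cover, and induction applies. -/

theorem completeOn_adj {S : Finset V} {x y : V} :
    (completeOn S).Adj x y ↔ x ≠ y ∧ x ∈ S ∧ y ∈ S := by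
  simp only [completeOn, SimpleGraph.fromRel_adj]
  tauto

theorem addVertex_adj {G : SimpleGraph V} {v : V} {C : Finset V} {x y : V} :
    (addVertex G v C).Adj x y ↔
      G.Adj x y ∨ x ≠ y ∧ (x = v ∧ y ∈ C ∨ y = v ∧ x ∈ C) := by
  simp only [addVertex, SimpleGraph.sup_adj, SimpleGraph.fromRel_adj]

variable [DecidableEq V]

theorem IsKTreeOn.mem_of_adj {k : ℕ} {S : Finset V} {G : SimpleGraph V} (h : IsKTreeOn k S G)
    {x y : V} (hxy : G.Adj x y) : x ∈ S := by
  induction h generalizing x y with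
  | complete S hS => exact (completeOn_adj.1 hxy).2.1
  | add S G hG v hv C hCS hC ih =>
    rcases addVertex_adj.1 hxy with h | ⟨-, ⟨rfl, -⟩ | ⟨-, h⟩⟩
    · exact Finset.mem_insert_of_mem (ih h)
    · exact Finset.mem_insert_self _ _
    · exact Finset.mem_insert_of_mem (hCS h)

/-- A perfect cover by triangles of the graph `G` on the vertex set `S`. -/
structure CoverOn (S : Finset V) (G : SimpleGraph V) (P : Finset (Finset V)) : Prop where
  clique : ∀ T ∈ P, G.IsNClique 3 T
  subset : ∀ T ∈ P, T ⊆ S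
  exists_mem : ∀ v ∈ S, ∃ T ∈ P, v ∈ T
  unique : ∀ T ∈ P, ∀ T' ∈ P, ∀ v ∈ T, v ∈ T' → T = T'

theorem isNClique_three {G : SimpleGraph V} {a b c : V} :
    G.IsNClique 3 {a, b, c} ↔ G.Adj a b ∧ G.Adj a c ∧ G.Adj b c :=
  SimpleGraph.is3Clique_triple_iff

theorem InFamilyE.coverOn {S : Finset V} {G : SimpleGraph V} {R B : Finset (Finset V)}
    (h : InFamilyE S G R B) : (∀ x y, G.Adj x y → x ∈ S) ∧ CoverOn S G R := by
  induction h with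
  | triangle T hT =>
    refine ⟨fun x y h => (completeOn_adj.1 h).2.1, ?_, ?_, ?_, ?_⟩
    · simp only [Finset.mem_singleton, forall_eq]
      refine ⟨fun x hx y hy hxy => completeOn_adj.2 ⟨hxy, hx, hy⟩, hT⟩
    · simp
    · simp
    · simp
  | op1 S G R B hG v₁ v₂ hv u₁ u₂ u₃ hu₁ hu₂ hu₃ h₁₂ h₁₃ h₂₃ ih =>
    obtain ⟨hS, ih⟩ := ih
    have hv₁ := hS _ _ hv
    have hv₂ := hS _ _ hv.symm
    refine ⟨?_, ?_, ?_, ?_, ?_⟩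
    · intro x y
      simp only [addVertex_adj, Finset.mem_union, Finset.mem_insert, Finset.mem_singleton]
      have := hS x y
      grind
    · intro T hT
      rcases Finset.mem_union.1 hT with hT | hT
      · exact (ih.clique T hT).mono fun x y h => by simp [addVertex_adj, h]
      · rw [Finset.mem_singleton.1 hT, isNClique_three]
        simp [addVertex_adj, h₁₂, h₁₃, h₂₃]
    · intro T hT
      rcases Finset.mem_union.1 hT with hT | hT
      · exact (ih.subset T hT).trans Finset.subset_union_left
      · rw [Finset.mem_singleton.1 hT]; exact Finset.subset_union_right
    · intro v hv
      rcases Finset.mem_union.1 hv with hv | hv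
      · obtain ⟨T, hT, h⟩ := ih.exists_mem v hv
        exact ⟨T, Finset.mem_union_left _ hT, h⟩
      · exact ⟨_, Finset.mem_union_right _ (Finset.mem_singleton_self _), hv⟩
    -- Old red triangles lie in `S`, and the new one avoids `S`.
    · have key : ∀ T ∈ R, ∀ v ∈ T, v ∉ ({u₁, u₂, u₃} : Finset V) := by
        intro T hT v hv
        have := ih.subset T hT hv
        simp only [Finset.mem_insert, Finset.mem_singleton]
        grind
      intro T hT T' hT' v hv hv'
      rcases Finset.mem_union.1 hT with hT | hT <;> rcases Finset.mem_union.1 hT' with hT' | hT'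
      · exact ih.unique T hT T' hT' v hv hv'
      · exact (key T hT v hv (Finset.mem_singleton.1 hT' ▸ hv')).elim
      · exact (key T' hT' v hv' (Finset.mem_singleton.1 hT ▸ hv)).elim
      · rw [Finset.mem_singleton.1 hT, Finset.mem_singleton.1 hT']
  | op2 S G R B hG v₁ v₂ v₃ v₄ hv₁₂ hv₁₃ hv₂₃ hred hv₃₄ u₀ u₁ u₂ hu₀ hu₁ hu₂ h₀₁ h₀₂ h₁₂ ih =>
    obtain ⟨hS, ih⟩ := ih
    have hv₁ := hS _ _ hv₁₂
    have hv₂ := hS _ _ hv₂₃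
    have hv₃ := hS _ _ hv₃₄
    have hv₄ := hS _ _ hv₃₄.symm
    have hmem : ∀ T, T ∈ (R \ {{v₁, v₂, v₃}}) ∪ {{u₀, v₁, v₂}, {v₃, u₁, u₂}} ↔
        (T ∈ R ∧ T ≠ {v₁, v₂, v₃}) ∨ T = {u₀, v₁, v₂} ∨ T = {v₃, u₁, u₂} := by
      intro T
      simp only [Finset.mem_union, Finset.mem_sdiff, Finset.mem_insert, Finset.mem_singleton]
    have key : ∀ T ∈ R, T ≠ {v₁, v₂, v₃} → ∀ v ∈ T,
        v ∉ ({u₀, v₁, v₂} : Finset V) ∧ v ∉ ({v₃, u₁, u₂} : Finset V) := by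
      intro T hT hne v hv
      have h1 := ih.subset T hT hv
      have h2 : v ∉ ({v₁, v₂, v₃} : Finset V) := fun h => hne (ih.unique T hT _ hred v hv h)
      simp only [Finset.mem_insert, Finset.mem_singleton] at h2 ⊢
      grind
    have key2 : ∀ v, v ∈ ({u₀, v₁, v₂} : Finset V) → v ∉ ({v₃, u₁, u₂} : Finset V) := by
      intro v
      simp only [Finset.mem_insert, Finset.mem_singleton]
      have := hv₁₃.ne
      have := hv₂₃.ne
      grind
    refine ⟨?_, ?_, ?_, ?_, ?_⟩
    · intro x y
      simp only [addVertex_adj, Finset.mem_union, Finset.mem_insert, Finset.mem_singleton]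
      have := hS x y
      grind
    · intro T hT
      rcases (hmem T).1 hT with ⟨hT, -⟩ | rfl | rfl
      · exact (ih.clique T hT).mono fun x y h => by simp [addVertex_adj, h]
      · rw [isNClique_three]
        simp only [addVertex_adj, Finset.mem_insert, Finset.mem_singleton]
        grind
      · rw [isNClique_three]
        simp only [addVertex_adj, Finset.mem_insert, Finset.mem_singleton]
        grind
    · intro T hT v hv
      rcases (hmem T).1 hT with ⟨hT, -⟩ | rfl | rfl
      · exact Finset.mem_union_left _ (ih.subset T hT hv)
      · simp only [Finset.mem_union, Finset.mem_insert, Finset.mem_singleton] at hv ⊢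
        grind
      · simp only [Finset.mem_union, Finset.mem_insert, Finset.mem_singleton] at hv ⊢
        grind
    · intro v hv
      by_cases h1 : v ∈ ({u₀, v₁, v₂} : Finset V)
      · exact ⟨_, (hmem _).2 (.inr (.inl rfl)), h1⟩
      by_cases h2 : v ∈ ({v₃, u₁, u₂} : Finset V)
      · exact ⟨_, (hmem _).2 (.inr (.inr rfl)), h2⟩
      have hvS : v ∈ S := by
        simp only [Finset.mem_union, Finset.mem_insert, Finset.mem_singleton] at hv h1 h2
        grind
      obtain ⟨T, hT, h⟩ := ih.exists_mem v hvS
      refine ⟨T, (hmem _).2 (.inl ⟨hT, ?_⟩), h⟩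
      rintro rfl
      simp only [Finset.mem_insert, Finset.mem_singleton] at h h1 h2
      grind
    · intro T hT T' hT' v hv hv'
      rcases (hmem T).1 hT with ⟨hT, hn⟩ | rfl | rfl <;>
        rcases (hmem T').1 hT' with ⟨hT', hn'⟩ | rfl | rfl
      · exact ih.unique T hT T' hT' v hv hv'
      · exact ((key T hT hn v hv).1 hv').elim
      · exact ((key T hT hn v hv).2 hv').elim
      · exact ((key T' hT' hn' v hv').1 hv).elim
      · rfl
      · exact (key2 v hv hv').elim
      · exact ((key T' hT' hn' v hv').2 hv).elim
      · exact (key2 v hv' hv).elim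
      · rfl

theorem IsKTreeOn.exists_coloring {k : ℕ} {S : Finset V} {G : SimpleGraph V}
    (h : IsKTreeOn k S G) : ∃ f : V → Fin (k + 1), ∀ x y, G.Adj x y → f x ≠ f y := by
  induction h with
  | complete S hS =>
    have e : S ≃ Fin k := Fintype.equivFinOfCardEq (by simpa using hS)
    refine ⟨fun v => if hv : v ∈ S then (e ⟨v, hv⟩).castSucc else Fin.last k, fun x y h => ?_⟩
    obtain ⟨hne, hx, hy⟩ := completeOn_adj.1 h
    simpa [hx, hy] using hne
  | add S G hG v hv C hCS hC ih =>
    obtain ⟨f, hf⟩ := ih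
    -- The `k` neighbors of the new vertex leave one of the `k + 1` colours free.
    obtain ⟨i, hi⟩ : ∃ i, i ∉ C.image f := by
      by_contra! h
      have := Finset.card_le_card (fun i _ => h i : Finset.univ ⊆ C.image f)
      have h2 := (Finset.card_image_le (s := C) (f := f))
      rw [hC.card_eq] at h2
      simp only [Finset.card_univ, Fintype.card_fin] at this
      omega
    have hi' : ∀ y ∈ C, f y ≠ i := fun y hy h => hi (Finset.mem_image.2 ⟨y, hy, h⟩)
    refine ⟨Function.update f v i, fun x y h => ?_⟩
    have hvC : v ∉ C := fun h => hv (hCS h)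
    rcases addVertex_adj.1 h with h | ⟨-, ⟨rfl, h'⟩ | ⟨rfl, h'⟩⟩
    · have hx : x ≠ v := fun e => hv (e ▸ hG.mem_of_adj h)
      have hy : y ≠ v := fun e => hv (e ▸ hG.mem_of_adj h.symm)
      simpa [hx, hy] using hf x y h
    · have : y ≠ x := fun e => hvC (e ▸ h')
      simpa [this] using (hi' y h').symm
    · have : x ≠ y := fun e => hvC (e ▸ h')
      simpa [this] using (hi' x h')

/-- Every set of vertices of a `k`-tree can be covered by cliques which are indexed by the elements
of an independent subset. -/
theorem IsKTreeOn.exists_cliqueCover {k : ℕ} {S : Finset V} {G : SimpleGraph V}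
    (h : IsKTreeOn k S G) : ∀ W ⊆ S, ∃ (I : Finset V) (Q : V → Finset V), I ⊆ W ∧
      G.IsIndepSet I ∧ (∀ i ∈ I, G.IsClique (Q i)) ∧ ∀ w ∈ W, ∃ i ∈ I, w ∈ Q i := by
  induction h with
  | complete S hS =>
    intro W hW
    rcases W.eq_empty_or_nonempty with rfl | ⟨w, hw⟩
    · exact ⟨∅, fun _ => ∅, by simp⟩
    · refine ⟨{w}, fun _ => W, by simpa using hw, by simp, ?_, fun v hv => ⟨w, by simp, hv⟩⟩
      intro _ _ x hx y hy hxy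
      exact completeOn_adj.2 ⟨hxy, hW hx, hW hy⟩
  | add S G hG v hv C hCS hC ih =>
    intro W hW
    have hvC : v ∉ C := fun h => hv (hCS h)
    have mono : ∀ {Q : Finset V}, G.IsClique Q → (addVertex G v C).IsClique Q := fun h =>
      h.mono fun x y h => addVertex_adj.2 (.inl h)
    have indep : ∀ {I : Finset V}, G.IsIndepSet I → v ∉ I →
        (addVertex G v C).IsIndepSet I := by
      intro I hI hvI x hx y hy hxy h
      have hx' : x ≠ v := fun e => hvI (e ▸ hx)
      have hy' : y ≠ v := fun e => hvI (e ▸ hy)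
      rcases addVertex_adj.1 h with h | ⟨-, ⟨rfl, h⟩ | ⟨rfl, h⟩⟩
      · exact hI hx hy hxy h
      · exact hx' rfl
      · exact hy' rfl
    -- If `v ∈ W`, the clique `insert v C` is assigned to `v`. It contains all neighbors of `v`, so
    -- `v` is independent of what remains of `W`. This removal is why the induction runs over
    -- arbitrary `W`.
    by_cases hvW : v ∈ W
    · obtain ⟨I, Q, hIW, hI, hQ, hc⟩ := ih (W \ insert v C) (by
        intro w hw
        have := Finset.mem_sdiff.1 hw
        have h2 := hW this.1
        simp only [Finset.mem_insert] at this h2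
        tauto)
      have hvI : v ∉ I := fun h => by simpa using hIW h
      refine ⟨insert v I, Function.update Q v (insert v C), ?_, ?_, ?_, ?_⟩
      · intro x hx
        rcases Finset.mem_insert.1 hx with rfl | hx
        · exact hvW
        · exact (Finset.mem_sdiff.1 (hIW hx)).1
      · have hvx : ∀ x ∈ I, ¬ (addVertex G v C).Adj v x := by
          intro x hx h
          rcases addVertex_adj.1 h with h | ⟨-, ⟨-, h⟩ | ⟨rfl, h⟩⟩
          · exact hv (hG.mem_of_adj h)
          · have := hIW hx
            simp [h] at this
          · exact hvI hx
        rw [Finset.coe_insert, SimpleGraph.IsIndepSet, Set.pairwise_insert]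
        exact ⟨indep hI hvI, fun x hx _ => ⟨hvx x hx, fun h => hvx x hx h.symm⟩⟩
      · intro i hi
        rcases eq_or_ne i v with rfl | hne
        · rw [Function.update_self, Finset.coe_insert, SimpleGraph.isClique_insert]
          exact ⟨mono hC.isClique, fun b hb hne => addVertex_adj.2 (.inr ⟨hne, .inl ⟨rfl, hb⟩⟩)⟩
        · rw [Function.update_of_ne hne]
          exact mono (hQ i ((Finset.mem_insert.1 hi).resolve_left hne))
      · intro w hw
        by_cases hwC : w ∈ insert v C
        · exact ⟨v, Finset.mem_insert_self _ _, by simpa using hwC⟩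
        · obtain ⟨i, hi, h⟩ := hc w (Finset.mem_sdiff.2 ⟨hw, hwC⟩)
          refine ⟨i, Finset.mem_insert_of_mem hi, ?_⟩
          rwa [Function.update_of_ne (fun e : i = v => hvI (e ▸ hi))]
    · obtain ⟨I, Q, hIW, hI, hQ, hc⟩ := ih W fun w hw =>
        (Finset.mem_insert.1 (hW hw)).resolve_left fun e => hvW (e ▸ hw)
      exact ⟨I, Q, hIW, indep hI fun h => hvW (hIW h), fun i hi => mono (hQ i hi), hc⟩

/-- In a `k`-tree with more than `k` vertices every clique is contained in one of order `k + 1`. -/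
theorem IsKTreeOn.exists_isNClique_superset {k : ℕ} {S : Finset V} {G : SimpleGraph V}
    (h : IsKTreeOn k S G) : ∀ Q ⊆ S, G.IsClique Q →
      S.card = k ∨ ∃ T, Q ⊆ T ∧ G.IsNClique (k + 1) T := by
  induction h with
  | complete S hS => exact fun _ _ _ => .inl hS
  | add S G hG v hv C hCS hC ih =>
    intro Q hQS hQ
    right
    have hvC : v ∉ C := fun h => hv (hCS h)
    have hle : G ≤ addVertex G v C := fun x y h => addVertex_adj.2 (.inl h)
    have hT : (addVertex G v C).IsNClique (k + 1) (insert v C) :=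
      (hC.mono hle).insert fun b hb =>
        addVertex_adj.2 (.inr ⟨fun e => hvC (e ▸ hb), .inl ⟨rfl, hb⟩⟩)
    by_cases hvQ : v ∈ Q
    · refine ⟨insert v C, fun x hx => ?_, hT⟩
      rcases eq_or_ne x v with rfl | hne
      · simp
      · rcases addVertex_adj.1 (hQ hvQ hx hne.symm) with h | ⟨-, ⟨-, h⟩ | ⟨h, -⟩⟩
        · exact (hv (hG.mem_of_adj h)).elim
        · exact Finset.mem_insert_of_mem h
        · exact (hne h).elim
    · have hQS' : Q ⊆ S := fun w hw =>
        (Finset.mem_insert.1 (hQS hw)).resolve_left fun e => hvQ (e ▸ hw)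
      have hQG : G.IsClique Q := by
        intro x hx y hy hxy
        rcases addVertex_adj.1 (hQ hx hy hxy) with h | ⟨-, ⟨rfl, h⟩ | ⟨rfl, h⟩⟩
        · exact h
        · exact (hvQ hx).elim
        · exact (hvQ hy).elim
      -- If the old graph had only `k` vertices, then `C` is all of them and `insert v C` serves.
      rcases ih Q hQS' hQG with h | ⟨T, hQT, hT'⟩
      · have : C = S := Finset.eq_of_subset_of_card_le hCS (by rw [hC.card_eq, h])
        exact ⟨insert v C, this ▸ hQS, hT⟩
      · exact ⟨T, hQT, hT'.mono hle⟩

end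

/-! ### Perfect covers and `α`-excellence. -/

section

variable {V : Type*}

/-- Two vertices of an independent set cannot share a triangle, so choosing a cover triangle for
each vertex is injective on `I`. -/
theorem CoverOn.card_le [Fintype V] [DecidableEq V] {G : SimpleGraph V}
    {P : Finset (Finset V)} (hP : CoverOn Finset.univ G P) {I : Finset V} (hI : G.IsIndepSet I) :
    I.card ≤ P.card := by
  choose f hf hmem using fun v => hP.exists_mem v (Finset.mem_univ v)
  refine Finset.card_le_card_of_injOn f (fun v _ => hf v) fun v hv w hw h => ?_
  by_contra hne
  exact hI hv hw hne ((hP.clique _ (hf v)).isClique (hmem v) (h ▸ hmem w) hne)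

theorem CoverOn.card_mul [Fintype V] [DecidableEq V] {G : SimpleGraph V}
    {P : Finset (Finset V)} (hP : CoverOn Finset.univ G P) : P.card * 3 = Fintype.card V := by
  have hU : (Finset.univ : Finset V) = P.biUnion id := by
    ext v
    simpa using hP.exists_mem v (Finset.mem_univ v)
  rw [← Finset.card_univ, hU, Finset.card_biUnion (t := id) fun T hT T' hT' hne =>
    Finset.disjoint_left.2 fun v hv hv' => hne (hP.unique T hT T' hT' v hv hv')]
  exact (Finset.sum_const_nat fun T hT => (hP.clique T hT).card_eq).symm

theorem isPerfectCover_iff_coverOn [Fintype V] [DecidableEq V] {G : SimpleGraph V}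
    {P : Finset (Finset V)} :
    IsPerfectCover G 3 (P : Set (Finset V)) ↔ CoverOn Finset.univ G P := by
  constructor
  · rintro ⟨h, h'⟩
    refine ⟨fun T hT => h T hT, fun T _ => Finset.subset_univ T, fun v _ => ?_, ?_⟩
    · obtain ⟨T, ⟨hT, hv⟩, -⟩ := h' v
      exact ⟨T, hT, hv⟩
    · exact fun T hT T' hT' v hv hv' => (h' v).unique ⟨hT, hv⟩ ⟨hT', hv'⟩
  · intro h
    refine ⟨fun T hT => h.clique T hT, fun v => ?_⟩
    obtain ⟨T, hT, hv⟩ := h.exists_mem v (Finset.mem_univ v)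
    exact ⟨T, ⟨hT, hv⟩, fun T' hT' => h.unique T' hT'.1 T hT v hT'.2 hv⟩

theorem exists_isPerfectCover_iff [Fintype V] [DecidableEq V] {G : SimpleGraph V} :
    (∃ P, IsPerfectCover G 3 P) ↔ ∃ P, CoverOn Finset.univ G P := by
  classical
  constructor
  · rintro ⟨P, hP⟩
    exact ⟨P.toFinset, isPerfectCover_iff_coverOn.1 (by simpa using hP)⟩
  · rintro ⟨P, hP⟩
    exact ⟨P, isPerfectCover_iff_coverOn.2 hP⟩

theorem CoverOn.isAlphaExcellent [Fintype V] [DecidableEq V] [Nonempty V] {G : SimpleGraph V}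
    (hG : IsKTree 2 G) {P : Finset (Finset V)} (hP : CoverOn Finset.univ G P) :
    IsAlphaExcellent G := by
  obtain ⟨f, hf⟩ := IsKTreeOn.exists_coloring hG
  have hind : ∀ i, G.IsIndepSet (Finset.univ.filter (f · = i) : Finset V) := by
    intro i x hx y hy _ hadj
    simp only [Finset.coe_filter, Finset.mem_univ, true_and, Set.mem_ofPred_eq] at hx hy
    exact hf x y hadj (hx.trans hy.symm)
  have hle := fun i => hP.card_le (hind i)
  have hsum := Finset.card_eq_sum_card_fiberwise (f := f) (s := Finset.univ) (t := Finset.univ)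
    (fun _ _ => by simp)
  rw [Fin.sum_univ_three, Finset.card_univ, ← hP.card_mul] at hsum
  -- Three numbers, each at most `|P|`, with sum `3|P|`.
  have heq : ∀ i, P.card ≤ (Finset.univ.filter (f · = i) : Finset V).card := by
    intro i
    have h0 := hle 0
    have h1 := hle 1
    have h2 := hle 2
    fin_cases i <;> simp only [Fin.zero_eta, Fin.mk_one, Fin.reduceFinMk] <;> omega
  refine (isAlphaExcellent_iff G).2 fun v => ⟨Finset.univ.filter (f · = f v),
    ⟨hind _, fun t ht => (hP.card_le ht).trans (heq _)⟩, by simp⟩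

theorem IsAlphaExcellent.exists_coverOn [Fintype V] [DecidableEq V] {G : SimpleGraph V}
    (hG : IsKTree 2 G) (hn : 3 ≤ Fintype.card V) (h : IsAlphaExcellent G) :
    ∃ P, CoverOn Finset.univ G P := by
  have : Nonempty V := Fintype.card_pos_iff.1 (by omega)
  rw [isAlphaExcellent_iff] at h
  obtain ⟨I, Q, -, hI, hQ, hc⟩ := IsKTreeOn.exists_cliqueCover hG Finset.univ subset_rfl
  have hT : ∀ i ∈ I, ∃ T, Q i ⊆ T ∧ G.IsNClique 3 T := fun i hi =>
    (IsKTreeOn.exists_isNClique_superset hG (Q i) (Finset.subset_univ _) (hQ i hi)).resolve_left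
      (by rw [Finset.card_univ]; omega)
  choose! T hQT hT using hT
  refine ⟨I.image T, ?_, fun _ _ => Finset.subset_univ _, ?_, ?_⟩
  · simpa using hT
  · intro v hv
    obtain ⟨i, hi, h⟩ := hc v hv
    exact ⟨T i, Finset.mem_image_of_mem _ hi, hQT i hi h⟩
  · have key : ∀ i ∈ I, ∀ j ∈ I, ∀ v ∈ T i, v ∈ T j → i = j := by
      intro i hi j hj v hvi hvj
      obtain ⟨X, hX, hvX⟩ := h v
      choose f hf hmem using fun v => hc v (Finset.mem_univ v)
      have huniq : ∀ k ∈ I, ∀ x ∈ X, ∀ y ∈ X, x ∈ T k → y ∈ T k → x = y := by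
        intro k hk x hx y hy hxk hyk
        by_contra hne
        exact hX.isIndepSet hx hy hne ((hT k hk).isClique hxk hyk hne)
      have hinj : Set.InjOn f X := fun x hx y hy hxy =>
        huniq (f x) (hf x) x hx y hy (hQT _ (hf x) (hmem x))
          (hxy ▸ hQT _ (hf y) (hmem y))
      -- Maximality of `X` gives `|I| ≤ |X|`, so every triangle `T k` contains a vertex of `X`; if
      -- `v ∈ T k`, that vertex must be `v` itself.
      have hsurj := Finset.surjOn_of_injOn_of_card_le f (s := X) (t := I) (fun x _ => hf x) hinj
        (hX.maximum I hI)
      have hfk : ∀ k ∈ I, v ∈ T k → k = f v := by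
        intro k hk hvk
        obtain ⟨x, hx, rfl⟩ := hsurj hk
        rw [huniq (f x) hk x hx v hvX (hQT _ (hf x) (hmem x)) hvk]
      rw [hfk i hi hvi, hfk j hj hvj]
    intro A hA B hB v hvA hvB
    obtain ⟨i, hi, rfl⟩ := Finset.mem_image.1 hA
    obtain ⟨j, hj, rfl⟩ := Finset.mem_image.1 hB
    rw [key i hi j hj v hvA hvB]

end

/-! ### Depth functions, and undoing the two operations. -/

section

variable {V : Type*}

/-- The graph obtained from `G` by removing the vertices in `U`. -/
def deleteVertices (G : SimpleGraph V) (U : Finset V) : SimpleGraph V where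
  Adj u v := G.Adj u v ∧ u ∉ U ∧ v ∉ U
  symm := ⟨fun _ _ h => ⟨h.1.symm, h.2.2, h.2.1⟩⟩
  loopless := ⟨fun _ h => h.1.ne rfl⟩

theorem deleteVertices_adj {G : SimpleGraph V} {U : Finset V} {u v : V} :
    (deleteVertices G U).Adj u v ↔ G.Adj u v ∧ u ∉ U ∧ v ∉ U :=
  Iff.rfl

/-- The depth function `d` exhibits `G` as a `2`-tree on `S` grown from a root edge: each vertex
of positive depth has exactly two neighbors which are not deeper than itself, these are adjacent,
and one of them is on the level just above. -/
structure Layered (S : Finset V) (G : SimpleGraph V) (d : V → ℕ) : Prop where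
  mem_of_adj : ∀ {u v}, G.Adj u v → u ∈ S
  exists_parents : ∀ v ∈ S, 0 < d v → ∃ a b, G.Adj v a ∧ G.Adj v b ∧ G.Adj a b ∧
    d b + 1 = d v ∧ d a ≤ d b ∧ ∀ u, G.Adj v u → d u ≤ d v → u = a ∨ u = b
  exists_root : ∃ r s, G.Adj r s ∧ d r = 0 ∧ d s = 0 ∧ ∀ v ∈ S, d v = 0 → v = r ∨ v = s

theorem IsKTreeOn.exists_layered [DecidableEq V] {S : Finset V} {G : SimpleGraph V}
    (h : IsKTreeOn 2 S G) : ∃ d, Layered S G d := by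
  induction h with
  | complete S hS =>
    obtain ⟨r, s, hrs, rfl⟩ := Finset.card_eq_two.1 hS
    exact ⟨fun _ => 0, fun h => (completeOn_adj.1 h).2.1, by simp,
      r, s, completeOn_adj.2 (by simpa using hrs), rfl, rfl, by simp⟩
  | add S G hG v hv C hCS hC ih =>
    obtain ⟨d, hd⟩ := ih
    obtain ⟨a, b, hab, hle, rfl⟩ : ∃ a b, G.Adj a b ∧ d a ≤ d b ∧ C = {a, b} := by
      obtain ⟨a, b, hab, rfl⟩ := Finset.card_eq_two.1 hC.card_eq
      have hab' := hC.isClique (by simp : a ∈ _) (by simp : b ∈ _) hab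
      rcases le_total (d a) (d b) with h | h
      · exact ⟨a, b, hab', h, rfl⟩
      · exact ⟨b, a, hab'.symm, h, Finset.pair_comm a b⟩
    have haS := hd.mem_of_adj hab
    have hbS := hd.mem_of_adj hab.symm
    have hav : a ≠ v := fun e => hv (e ▸ haS)
    have hbv : b ≠ v := fun e => hv (e ▸ hbS)
    -- The new vertex is placed one level below its deeper neighbor `b`.
    have hadj : ∀ x y, (addVertex G v {a, b}).Adj x y ↔
        G.Adj x y ∨ (x = v ∧ (y = a ∨ y = b) ∨ y = v ∧ (x = a ∨ x = b)) := by
      intro x y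
      simp only [addVertex_adj, Finset.mem_insert, Finset.mem_singleton]
      grind
    have hGv : ∀ x, ¬ G.Adj v x := fun x h => hv (hd.mem_of_adj h)
    have hupd : ∀ x, x ≠ v → Function.update d v (d b + 1) x = d x := fun x hx => by simp [hx]
    refine ⟨Function.update d v (d b + 1), ?_, ?_, ?_⟩
    · intro x y h
      rw [Finset.mem_insert]
      have := hd.mem_of_adj (u := x) (v := y)
      grind
    · intro x hx hpos
      rcases eq_or_ne x v with rfl | hne
      · refine ⟨a, b, ?_, ?_, ?_, ?_, ?_, ?_⟩ <;> simp only [hadj, hupd a hav, hupd b hbv]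
        · simp
        · simp
        · exact .inl hab
        · simp
        · exact hle
        · grind
      · have hxS := (Finset.mem_insert.1 hx).resolve_left hne
        rw [hupd x hne] at hpos
        obtain ⟨p, q, hp, hq, hpq, h1, h2, h3⟩ := hd.exists_parents x hxS hpos
        have hpv : p ≠ v := fun e => hGv x (e ▸ hp.symm)
        have hqv : q ≠ v := fun e => hGv x (e ▸ hq.symm)
        refine ⟨p, q, ?_, ?_, ?_, ?_, ?_, ?_⟩ <;>
          simp only [hadj, hupd p hpv, hupd q hqv, hupd x hne]
        · exact .inl hp
        · exact .inl hq
        · exact .inl hpq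
        · exact h1
        · exact h2
        · intro u hu hdu
          rcases eq_or_ne u v with rfl | huv
          · rw [Function.update_self] at hdu
            have := hGv x
            have := G.adj_comm x u
            exfalso
            grind
          · rw [hupd u huv] at hdu
            exact h3 u (by grind) hdu
    · obtain ⟨r, s, hrs, hr, hs, h⟩ := hd.exists_root
      have hrv : r ≠ v := fun e => hGv s (e ▸ hrs)
      have hsv : s ≠ v := fun e => hGv r (e ▸ hrs.symm)
      refine ⟨r, s, (hadj _ _).2 (.inl hrs), by rw [hupd r hrv, hr], by rw [hupd s hsv, hs], ?_⟩
      intro x hx hx0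
      rcases eq_or_ne x v with rfl | hne
      · simp at hx0
      · exact h x ((Finset.mem_insert.1 hx).resolve_left hne) (by rwa [hupd x hne] at hx0)

/-- A surviving vertex keeps both parents, since by `hU` a deleted parent would take its child
along; the root edge survives by `hpos`. The same `d` serves the smaller graph, so it can stay fixed
in the induction. -/
theorem Layered.deleteVertices [DecidableEq V] {S : Finset V} {G : SimpleGraph V} {d : V → ℕ}
    (hd : Layered S G d) {U : Finset V} (hpos : ∀ u ∈ U, 0 < d u)
    (hU : ∀ u ∈ U, ∀ v, G.Adj u v → d u ≤ d v → v ∈ U) :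
    Layered (S \ U) (deleteVertices G U) d := by
  refine ⟨fun h => Finset.mem_sdiff.2 ⟨hd.mem_of_adj h.1, h.2.1⟩, ?_, ?_⟩
  · intro v hv hv0
    obtain ⟨hvS, hvU⟩ := Finset.mem_sdiff.1 hv
    obtain ⟨a, b, ha, hb, hab, h1, h2, h3⟩ := hd.exists_parents v hvS hv0
    have haU : a ∉ U := fun h => hvU (hU a h v ha.symm (by omega))
    have hbU : b ∉ U := fun h => hvU (hU b h v hb.symm (by omega))
    exact ⟨a, b, ⟨ha, hvU, haU⟩, ⟨hb, hvU, hbU⟩, ⟨hab, haU, hbU⟩, h1, h2, fun u hu => h3 u hu.1⟩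
  · obtain ⟨r, s, hrs, hr, hs, h⟩ := hd.exists_root
    have hrU : r ∉ U := fun h => (hpos r h).ne' hr
    have hsU : s ∉ U := fun h => (hpos s h).ne' hs
    exact ⟨r, s, ⟨hrs, hrU, hsU⟩, hr, hs, fun v hv => h v (Finset.mem_sdiff.1 hv).1⟩

theorem CoverOn.deleteVertices_op1 [DecidableEq V] {S : Finset V} {G : SimpleGraph V}
    {P : Finset (Finset V)} (hP : CoverOn S G P) {U : Finset V} (hU : U ∈ P) :
    CoverOn (S \ U) (deleteVertices G U) (P \ {U}) := by
  have key : ∀ T ∈ P \ {U}, T ∈ P ∧ ∀ v ∈ T, v ∉ U := by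
    intro T hT
    obtain ⟨hT, hne⟩ := Finset.mem_sdiff.1 hT
    exact ⟨hT, fun v hv hvU => hne (Finset.mem_singleton.2 (hP.unique T hT U hU v hv hvU))⟩
  refine ⟨fun T hT => ⟨fun x hx y hy hxy => ?_, (hP.clique T (key T hT).1).card_eq⟩,
    fun T hT v hv => ?_, fun v hv => ?_, fun T hT T' hT' => ?_⟩
  · exact ⟨(hP.clique T (key T hT).1).isClique hx hy hxy, (key T hT).2 x hx, (key T hT).2 y hy⟩
  · exact Finset.mem_sdiff.2 ⟨hP.subset T (key T hT).1 hv, (key T hT).2 v hv⟩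
  · obtain ⟨hv, hvU⟩ := Finset.mem_sdiff.1 hv
    obtain ⟨T, hT, h⟩ := hP.exists_mem v hv
    refine ⟨T, Finset.mem_sdiff.2 ⟨hT, fun e => hvU ?_⟩, h⟩
    rwa [Finset.mem_singleton.1 e] at h
  · exact hP.unique T (key T hT).1 T' (key T' hT').1

theorem CoverOn.inFamilyE_of_op1 [DecidableEq V] {S : Finset V} {G : SimpleGraph V}
    {P : Finset (Finset V)} (hP : CoverOn S G P) {v₁ v₂ u₁ u₂ u₃ : V} (hv : G.Adj v₁ v₂)
    (hT : {u₁, u₂, u₃} ∈ P) (hv₁u₂ : v₁ ≠ u₂) (hv₁u₃ : v₁ ≠ u₃) (hv₂u₃ : v₂ ≠ u₃)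
    (h₁ : ∀ u, G.Adj u₁ u ↔ u = v₁ ∨ u = v₂ ∨ u = u₂ ∨ u = u₃)
    (h₂ : ∀ u, G.Adj u₂ u ↔ u = v₂ ∨ u = u₁ ∨ u = u₃)
    (h₃ : ∀ u, G.Adj u₃ u ↔ u = u₁ ∨ u = u₂)
    (ih : ∃ B, InFamilyE (S \ {u₁, u₂, u₃}) (deleteVertices G {u₁, u₂, u₃})
      (P \ {{u₁, u₂, u₃}}) B) :
    ∃ B, InFamilyE S G P B := by
  obtain ⟨B, ih⟩ := ih
  have ne₁ : v₁ ≠ u₁ := ((h₁ v₁).2 (by simp)).ne'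
  have ne₂ : v₂ ≠ u₁ := ((h₁ v₂).2 (by simp)).ne'
  have ne₃ : v₂ ≠ u₂ := ((h₂ v₂).2 (by simp)).ne'
  have h₁₂ : u₁ ≠ u₂ := ((h₁ u₂).2 (by simp)).ne
  have h₁₃ : u₁ ≠ u₃ := ((h₁ u₃).2 (by simp)).ne
  have h₂₃ : u₂ ≠ u₃ := ((h₂ u₃).2 (by simp)).ne
  have key := InFamilyE.op1 _ _ _ _ ih v₁ v₂ ⟨hv, by simp [*], by simp [*]⟩ u₁ u₂ u₃
    (by simp) (by simp) (by simp) h₁₂ h₁₃ h₂₃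
  refine ⟨B ∪ {{v₁, v₂, u₁}, {v₂, u₁, u₂}}, ?_⟩
  convert key using 1
  · exact (Finset.sdiff_union_of_subset (hP.subset _ hT)).symm
  · ext x y
    have := G.adj_comm x y
    simp only [addVertex_adj, deleteVertices_adj, Finset.mem_insert, Finset.mem_singleton]
    by_cases hx : x = u₁ ∨ x = u₂ ∨ x = u₃
    · grind
    · by_cases hy : y = u₁ ∨ y = u₂ ∨ y = u₃ <;> grind
  · exact (Finset.sdiff_union_of_subset (by simpa using hT)).symm

/-- The two cover triangles are distinct because of `hne`, hence disjoint; after the deletion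
exactly `v₁, v₂, v₃` remain of them, and these form a triangle. -/
theorem CoverOn.deleteVertices_op2 [DecidableEq V] {S : Finset V} {G : SimpleGraph V}
    {P : Finset (Finset V)} (hP : CoverOn S G P) {v₁ v₂ v₃ u₀ u₁ u₂ : V}
    (h₁₂ : G.Adj v₁ v₂) (h₁₃ : G.Adj v₁ v₃) (h₂₃ : G.Adj v₂ v₃)
    (hT : {u₀, v₁, v₂} ∈ P) (hT' : {v₃, u₁, u₂} ∈ P) (hne : v₃ ≠ u₀) :
    CoverOn (S \ {u₀, u₁, u₂}) (deleteVertices G {u₀, u₁, u₂})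
      ((P \ {{u₀, v₁, v₂}, {v₃, u₁, u₂}}) ∪ {{v₁, v₂, v₃}}) := by
  have hmem : ∀ T, T ∈ (P \ {{u₀, v₁, v₂}, {v₃, u₁, u₂}}) ∪ {{v₁, v₂, v₃}} ↔
      (T ∈ P ∧ T ≠ {u₀, v₁, v₂} ∧ T ≠ {v₃, u₁, u₂}) ∨ T = {v₁, v₂, v₃} := by
    intro T
    simp only [Finset.mem_union, Finset.mem_sdiff, Finset.mem_insert, Finset.mem_singleton]
    tauto
  obtain ⟨a1, a2, -⟩ := isNClique_three.1 (hP.clique _ hT)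
  obtain ⟨a3, a4, a5⟩ := isNClique_three.1 (hP.clique _ hT')
  have disj : ∀ v, v ∈ ({u₀, v₁, v₂} : Finset V) → v ∉ ({v₃, u₁, u₂} : Finset V) := by
    intro v hv hv'
    have e := hP.unique _ hT _ hT' v hv hv'
    have : v₃ ∈ ({u₀, v₁, v₂} : Finset V) := by simp [e]
    simp only [Finset.mem_insert, Finset.mem_singleton] at this
    have := h₁₃.ne
    have := h₂₃.ne
    grind
  have d₁ := disj v₁ (by simp)
  have d₂ := disj v₂ (by simp)
  have b₁ : v₁ ∉ ({u₀, u₁, u₂} : Finset V) := by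
    have := a1.ne
    simp only [Finset.mem_insert, Finset.mem_singleton] at d₁ ⊢
    grind
  have b₂ : v₂ ∉ ({u₀, u₁, u₂} : Finset V) := by
    have := a2.ne
    simp only [Finset.mem_insert, Finset.mem_singleton] at d₂ ⊢
    grind
  have b₃ : v₃ ∉ ({u₀, u₁, u₂} : Finset V) := by
    have := a3.ne
    have := a4.ne
    simp only [Finset.mem_insert, Finset.mem_singleton]
    grind
  have key : ∀ T ∈ P, T ≠ {u₀, v₁, v₂} → T ≠ {v₃, u₁, u₂} → ∀ v ∈ T,
      v ∉ ({u₀, u₁, u₂} : Finset V) ∧ v ∉ ({v₁, v₂, v₃} : Finset V) := by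
    intro T hTP hn hn' v hv
    have c1 : v ∉ ({u₀, v₁, v₂} : Finset V) := fun h => hn (hP.unique _ hTP _ hT v hv h)
    have c2 : v ∉ ({v₃, u₁, u₂} : Finset V) := fun h => hn' (hP.unique _ hTP _ hT' v hv h)
    simp only [Finset.mem_insert, Finset.mem_singleton] at c1 c2 ⊢
    tauto
  refine ⟨fun T hTP => ?_, fun T hTP v hv => ?_, fun v hv => ?_, fun T hTP T' hTP' v hv hv' => ?_⟩
  · rcases (hmem T).1 hTP with ⟨hTP, hn, hn'⟩ | rfl
    · refine ⟨fun x hx y hy hxy => ?_, (hP.clique T hTP).card_eq⟩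
      exact ⟨(hP.clique T hTP).isClique hx hy hxy, (key T hTP hn hn' x hx).1,
        (key T hTP hn hn' y hy).1⟩
    · exact isNClique_three.2 ⟨⟨h₁₂, b₁, b₂⟩, ⟨h₁₃, b₁, b₃⟩, ⟨h₂₃, b₂, b₃⟩⟩
  · rcases (hmem T).1 hTP with ⟨hTP, hn, hn'⟩ | rfl
    · exact Finset.mem_sdiff.2 ⟨hP.subset T hTP hv, (key T hTP hn hn' v hv).1⟩
    · have m₁ := hP.subset _ hT (by simp : v₁ ∈ _)
      have m₂ := hP.subset _ hT (by simp : v₂ ∈ _)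
      have m₃ := hP.subset _ hT' (by simp : v₃ ∈ _)
      rw [Finset.mem_sdiff]
      simp only [Finset.mem_insert, Finset.mem_singleton] at hv
      rcases hv with rfl | rfl | rfl
      · exact ⟨m₁, b₁⟩
      · exact ⟨m₂, b₂⟩
      · exact ⟨m₃, b₃⟩
  · obtain ⟨hv, hvU⟩ := Finset.mem_sdiff.1 hv
    by_cases hvT : v ∈ ({v₁, v₂, v₃} : Finset V)
    · exact ⟨_, (hmem _).2 (.inr rfl), hvT⟩
    obtain ⟨T, hTP, h⟩ := hP.exists_mem v hv
    refine ⟨T, (hmem T).2 (.inl ⟨hTP, ?_, ?_⟩), h⟩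
    · rintro rfl
      simp only [Finset.mem_insert, Finset.mem_singleton] at h hvU hvT
      tauto
    · rintro rfl
      simp only [Finset.mem_insert, Finset.mem_singleton] at h hvU hvT
      tauto
  · rcases (hmem T).1 hTP with ⟨hTP, hn, hn'⟩ | rfl <;>
      rcases (hmem T').1 hTP' with ⟨hTP', m, m'⟩ | rfl
    · exact hP.unique T hTP T' hTP' v hv hv'
    · exact ((key T hTP hn hn' v hv).2 hv').elim
    · exact ((key T' hTP' m m' v hv').2 hv).elim
    · rfl

theorem CoverOn.inFamilyE_of_op2 [DecidableEq V] {S : Finset V} {G : SimpleGraph V}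
    {P : Finset (Finset V)} (hP : CoverOn S G P) {v₁ v₂ v₃ v₄ u₀ u₁ u₂ : V}
    (h₁₂ : G.Adj v₁ v₂) (h₁₃ : G.Adj v₁ v₃) (h₂₃ : G.Adj v₂ v₃) (h₃₄ : G.Adj v₃ v₄)
    (hT : {u₀, v₁, v₂} ∈ P) (hT' : {v₃, u₁, u₂} ∈ P) (hne : v₃ ≠ u₀) (hne' : v₄ ≠ u₂)
    (n₀ : ∀ u, G.Adj u₀ u ↔ u = v₁ ∨ u = v₂)
    (n₁ : ∀ u, G.Adj u₁ u ↔ u = v₃ ∨ u = v₄ ∨ u = u₂)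
    (n₂ : ∀ u, G.Adj u₂ u ↔ u = v₃ ∨ u = u₁)
    (ih : ∃ B, InFamilyE (S \ {u₀, u₁, u₂}) (deleteVertices G {u₀, u₁, u₂})
      ((P \ {{u₀, v₁, v₂}, {v₃, u₁, u₂}}) ∪ {{v₁, v₂, v₃}}) B) :
    ∃ B, InFamilyE S G P B := by
  obtain ⟨B, ih⟩ := ih
  obtain ⟨a1, a2, -⟩ := isNClique_three.1 (hP.clique _ hT)
  obtain ⟨a3, a4, a5⟩ := isNClique_three.1 (hP.clique _ hT')
  have e₁ := h₁₃.ne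
  have e₂ := h₂₃.ne
  have e₃ := a1.ne
  have e₄ := a2.ne
  have e₅ := a3.ne
  have e₆ := a4.ne
  have e₇ := a5.ne
  have e₈ : v₄ ≠ u₁ := ((n₁ v₄).2 (by simp)).ne'
  have e₉ : v₄ ≠ u₀ := by
    rintro rfl
    have := (n₀ v₃).1 h₃₄.symm
    grind
  -- In particular `{v₁, v₂, v₃} ∉ P`, so removing this red triangle in `𝒪₂` gives back exactly `P`.
  have hnot : ∀ T ∈ P, v₁ ∈ T → v₃ ∉ T := by
    intro T hTP hv₁ hv₃
    have e := hP.unique _ hTP _ hT v₁ hv₁ (by simp)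
    rw [e] at hv₃
    simp only [Finset.mem_insert, Finset.mem_singleton] at hv₃
    grind
  have d₁ : v₁ ∉ ({v₃, u₁, u₂} : Finset V) := fun h => hnot _ hT' h (by simp)
  have d₂ : v₂ ∉ ({v₃, u₁, u₂} : Finset V) := fun h => by
    have e := hP.unique _ hT _ hT' v₂ (by simp) h
    exact hnot _ hT (by simp) (by rw [e]; simp)
  have d₃ : u₀ ∉ ({v₃, u₁, u₂} : Finset V) := fun h => by
    have e := hP.unique _ hT _ hT' u₀ (by simp) h
    exact hnot _ hT (by simp) (by rw [e]; simp)
  simp only [Finset.mem_insert, Finset.mem_singleton, not_or] at d₁ d₂ d₃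
  have key := InFamilyE.op2 _ _ _ _ ih v₁ v₂ v₃ v₄ ⟨h₁₂, by simp; grind, by simp; grind⟩
    ⟨h₁₃, by simp; grind, by simp; grind⟩ ⟨h₂₃, by simp; grind, by simp; grind⟩ (by simp)
    ⟨h₃₄, by simp; grind, by simp; grind⟩ u₀ u₁ u₂ (by simp) (by simp) (by simp)
    d₃.2.1 d₃.2.2 e₇
  refine ⟨B ∪ {{v₁, v₂, v₃}, {v₃, v₄, u₁}}, ?_⟩
  convert key using 1
  · refine (Finset.sdiff_union_of_subset fun x hx => ?_).symm
    simp only [Finset.mem_insert, Finset.mem_singleton] at hx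
    rcases hx with rfl | rfl | rfl
    · exact hP.subset _ hT (by simp)
    · exact hP.subset _ hT' (by simp)
    · exact hP.subset _ hT' (by simp)
  · ext x y
    have := G.adj_comm x y
    simp only [addVertex_adj, deleteVertices_adj, Finset.mem_insert, Finset.mem_singleton]
    clear key ih hT hT' hnot
    by_cases hx : x = u₀ ∨ x = u₁ ∨ x = u₂
    · rcases hx with rfl | rfl | rfl
      · rw [n₀]; grind
      · rw [n₁]; grind
      · rw [n₂]; grind
    · by_cases hy : y = u₀ ∨ y = u₁ ∨ y = u₂
      · rcases hy with rfl | rfl | rfl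
        · rw [this, n₀]; grind
        · rw [this, n₁]; grind
        · rw [this, n₂]; grind
      · grind
  · ext T
    have hn : T ∈ P → T ≠ {v₁, v₂, v₃} := by
      rintro hTP rfl
      exact hnot _ hTP (by simp) (by simp)
    simp only [Finset.mem_union, Finset.mem_sdiff, Finset.mem_insert, Finset.mem_singleton]
    grind

end

/-! ### Induction from a deepest vertex: every perfect cover is a red set. -/

section

variable {V : Type*}

theorem Layered.mem_of_adj' {S : Finset V} {G : SimpleGraph V} {d : V → ℕ} (hd : Layered S G d)
    {u v : V} (h : G.Adj u v) : v ∈ S :=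
  hd.mem_of_adj h.symm

/-- The two non-deeper neighbors of a vertex of positive depth are strictly shallower, so only the
root edge can lie within a level. -/
theorem Layered.depth_eq_zero {S : Finset V} {G : SimpleGraph V} {d : V → ℕ}
    (hd : Layered S G d) {u v : V} (huv : G.Adj u v) (h : d u = d v) : d v = 0 := by
  by_contra h0
  obtain ⟨a, b, -, -, -, h1, h2, h3⟩ :=
    hd.exists_parents v (hd.mem_of_adj huv.symm) (Nat.pos_of_ne_zero h0)
  rcases h3 u huv.symm h.le with rfl | rfl <;> omega

/-- A vertex with at most two neighbors has no choice of cover triangle; this is how the cover gets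
forced at leaves. -/
theorem CoverOn.mem_of_neighbors [DecidableEq V] {S : Finset V} {G : SimpleGraph V}
    {P : Finset (Finset V)} (hP : CoverOn S G P) {x a b : V} (hx : x ∈ S)
    (h : ∀ u, G.Adj x u → u = a ∨ u = b) : {x, a, b} ∈ P := by
  obtain ⟨T, hT, hxT⟩ := hP.exists_mem x hx
  have hsub : T ⊆ {x, a, b} := by
    intro u hu
    by_cases hne : x = u
    · simp [hne]
    · have := h u ((hP.clique T hT).isClique hxT hu hne)
      simp [this]
  have := Finset.eq_of_subset_of_card_le hsub
    (by rw [(hP.clique T hT).card_eq]; exact Finset.card_le_three)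
  exact this ▸ hT

theorem Layered.exists_neighbors_of_leaf {S : Finset V} {G : SimpleGraph V} {d : V → ℕ}
    (hd : Layered S G d) {x : V} (hx : x ∈ S) (hpos : 0 < d x)
    (h : ∀ u, G.Adj x u → d u ≤ d x) :
    ∃ a b, G.Adj a b ∧ d b + 1 = d x ∧ d a ≤ d b ∧ ∀ u, G.Adj x u ↔ u = a ∨ u = b := by
  obtain ⟨a, b, ha, hb, hab, h1, h2, h3⟩ := hd.exists_parents x hx hpos
  exact ⟨a, b, hab, h1, h2, fun u => ⟨fun hu => h3 u hu (h u hu), by rintro (rfl | rfl) <;> assumption⟩⟩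

/-- The structure of a `2`-tree with a perfect cover around a vertex `z` all of whose children are
leaves, provided there is such a child `w`. -/
theorem Layered.exists_neighbors_of_child [DecidableEq V] {S : Finset V} {G : SimpleGraph V}
    {d : V → ℕ} {P : Finset (Finset V)} (hd : Layered S G d) (hP : CoverOn S G P) {z w : V}
    (hpos : 0 < d z) (hmax : ∀ v ∈ S, d v ≤ d z + 1) (hzw : G.Adj z w) (hlt : d z < d w) :
    ∃ y y', d y < d z ∧ d y' < d z ∧ G.Adj y y' ∧ (d y + 1 = d z ∨ d y' + 1 = d z) ∧
      (∀ u, G.Adj w u ↔ u = y ∨ u = z) ∧ (∀ u, G.Adj z u ↔ u = y ∨ u = y' ∨ u = w) ∧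
      {w, y, z} ∈ P := by
  have child : ∀ w, G.Adj z w → d z < d w →
      ∃ y, G.Adj z y ∧ d y < d z ∧ (∀ u, G.Adj w u ↔ u = y ∨ u = z) ∧ {w, y, z} ∈ P := by
    intro w hzw hlt
    have hw := hd.mem_of_adj' hzw
    have hw' := hmax w hw
    obtain ⟨a, b, hab, h1, h2, h3⟩ := hd.exists_neighbors_of_leaf hw (by omega) fun u hu =>
      (hmax u (hd.mem_of_adj' hu)).trans (by omega)
    have hne : d a ≠ d b := fun e => by
      have := hd.depth_eq_zero hab e
      omega
    have hz : z = b := by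
      rcases (h3 z).1 hzw.symm with rfl | rfl
      · omega
      · rfl
    subst hz
    exact ⟨a, hab.symm, by omega, h3, hP.mem_of_neighbors hw fun u => (h3 u).1⟩
  obtain ⟨y, hzy, hy, hw, hT⟩ := child w hzw hlt
  -- The forced triangle of each child contains `z`, so there is only one child.
  have hyw : ∀ u, G.Adj z u → d z < d u → u = w := by
    intro u hzu hu
    obtain ⟨y', -, hy', -, hT'⟩ := child u hzu hu
    have e := hP.unique _ hT' _ hT z (by simp) (by simp)
    have hmem : u ∈ ({w, y, z} : Finset V) := by rw [← e]; simp
    simp only [Finset.mem_insert, Finset.mem_singleton] at hmem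
    rcases hmem with rfl | rfl | rfl
    · rfl
    · omega
    · omega
  obtain ⟨a, b, ha, hb, hab, h1, h2, h3⟩ := hd.exists_parents z (hd.mem_of_adj hzw) hpos
  have hN : ∀ u, G.Adj z u ↔ u = a ∨ u = b ∨ u = w := by
    intro u
    constructor
    · intro hu
      rcases le_or_gt (d u) (d z) with h | h
      · have := h3 u hu h
        tauto
      · exact .inr (.inr (hyw u hu h))
    · rintro (rfl | rfl | rfl) <;> assumption
  rcases h3 y hzy hy.le with rfl | rfl
  · exact ⟨y, b, hy, by omega, hab, .inr h1, hw, hN, hT⟩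
  · exact ⟨y, a, hy, by omega, hab.symm, .inl h1, hw, fun u => by rw [hN]; tauto, hT⟩

theorem Layered.inFamilyE_of_op1 [DecidableEq V] {S : Finset V} {G : SimpleGraph V}
    {d : V → ℕ} {P : Finset (Finset V)} (hd : Layered S G d) (hP : CoverOn S G P)
    (ih : ∀ S' ⊂ S, ∀ G' P', Layered S' G' d → CoverOn S' G' P' → ∃ B, InFamilyE S' G' P' B)
    {v₁ v₂ u₁ u₂ u₃ : V} (hv : G.Adj v₁ v₂) (hT : {u₁, u₂, u₃} ∈ P)
    (d₁ : d v₁ < d u₁) (d₂ : d v₂ < d u₁) (d₃ : d u₁ < d u₂) (d₄ : d u₂ < d u₃)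
    (h₁ : ∀ u, G.Adj u₁ u ↔ u = v₁ ∨ u = v₂ ∨ u = u₂ ∨ u = u₃)
    (h₂ : ∀ u, G.Adj u₂ u ↔ u = v₂ ∨ u = u₁ ∨ u = u₃)
    (h₃ : ∀ u, G.Adj u₃ u ↔ u = u₁ ∨ u = u₂) :
    ∃ B, InFamilyE S G P B := by
  refine hP.inFamilyE_of_op1 hv hT (by grind) (by grind) (by grind) h₁ h₂ h₃
    (ih _ ?_ _ _ (hd.deleteVertices ?_ ?_) (hP.deleteVertices_op1 hT))
  · exact Finset.sdiff_ssubset (hP.subset _ hT) ⟨u₁, by simp⟩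
  · simp only [Finset.mem_insert, Finset.mem_singleton]
    grind
  · simp only [Finset.mem_insert, Finset.mem_singleton]
    grind

theorem Layered.inFamilyE_of_op2 [DecidableEq V] {S : Finset V} {G : SimpleGraph V}
    {d : V → ℕ} {P : Finset (Finset V)} (hd : Layered S G d) (hP : CoverOn S G P)
    (ih : ∀ S' ⊂ S, ∀ G' P', Layered S' G' d → CoverOn S' G' P' → ∃ B, InFamilyE S' G' P' B)
    {v₁ v₂ v₃ v₄ u₀ u₁ u₂ : V}
    (h₁₂ : G.Adj v₁ v₂) (h₁₃ : G.Adj v₁ v₃) (h₂₃ : G.Adj v₂ v₃) (h₃₄ : G.Adj v₃ v₄)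
    (hT : {u₀, v₁, v₂} ∈ P) (hT' : {v₃, u₁, u₂} ∈ P) (hne : v₃ ≠ u₀)
    (d₁ : d v₁ < d u₀) (d₂ : d v₂ < d u₀) (d₃ : d v₃ < d u₁) (d₄ : d v₄ < d u₁)
    (d₅ : d u₁ < d u₂)
    (n₀ : ∀ u, G.Adj u₀ u ↔ u = v₁ ∨ u = v₂)
    (n₁ : ∀ u, G.Adj u₁ u ↔ u = v₃ ∨ u = v₄ ∨ u = u₂)
    (n₂ : ∀ u, G.Adj u₂ u ↔ u = v₃ ∨ u = u₁) :
    ∃ B, InFamilyE S G P B := by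
  refine hP.inFamilyE_of_op2 h₁₂ h₁₃ h₂₃ h₃₄ hT hT' hne (by grind) n₀ n₁ n₂
    (ih _ ?_ _ _ (hd.deleteVertices ?_ ?_) (hP.deleteVertices_op2 h₁₂ h₁₃ h₂₃ hT hT' hne))
  · exact Finset.ssubset_iff_subset_ne.2 ⟨Finset.sdiff_subset, fun e => by
      have := hP.subset _ hT (by simp : u₀ ∈ _)
      rw [← e] at this
      simp at this⟩
  · simp only [Finset.mem_insert, Finset.mem_singleton]
    grind
  · simp only [Finset.mem_insert, Finset.mem_singleton]
    grind

theorem Layered.inFamilyE_of_depth_eq_one [DecidableEq V] {S : Finset V} {G : SimpleGraph V}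
    {d : V → ℕ} {P : Finset (Finset V)} (hd : Layered S G d) (hP : CoverOn S G P) {x : V}
    (hx : x ∈ S) (hx1 : d x = 1) (hmax : ∀ v ∈ S, d v ≤ 1) :
    ∃ B, InFamilyE S G P B := by
  obtain ⟨r, s, hrs, hr, hs, hroot⟩ := hd.exists_root
  -- All forced triangles contain `r`, so only one vertex has depth 1 and the graph is a triangle.
  have leaf : ∀ v ∈ S, d v = 1 → {v, r, s} ∈ P := by
    intro v hv hv1
    obtain ⟨a, b, hab, h1, h2, h3⟩ := hd.exists_neighbors_of_leaf hv (by omega) fun u hu =>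
      hv1.symm ▸ hmax u (hd.mem_of_adj' hu)
    have ha := hroot a (hd.mem_of_adj hab) (by omega)
    have hb := hroot b (hd.mem_of_adj' hab) (by omega)
    exact hP.mem_of_neighbors hv fun u hu => by grind
  have hT := leaf x hx hx1
  have hS : S = {x, r, s} := by
    refine subset_antisymm (fun v hv => ?_) (hP.subset _ hT)
    have := hmax v hv
    rcases Nat.lt_or_ge 0 (d v) with h | h
    · rw [← hP.unique _ (leaf v hv (by omega)) _ hT r (by simp) (by simp)]
      simp
    · have := hroot v hv (by omega)
      simp [this]
  have hG : G = completeOn S := by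
    ext u v
    rw [completeOn_adj]
    refine ⟨fun h => ⟨h.ne, hd.mem_of_adj h, hd.mem_of_adj' h⟩, fun ⟨h, hu, hv⟩ => ?_⟩
    rw [hS] at hu hv
    exact (hP.clique _ hT).isClique hu hv h
  have hPS : P = {S} := by
    refine Finset.eq_singleton_iff_unique_mem.2 ⟨hS ▸ hT, fun T hT' => ?_⟩
    refine Finset.eq_of_subset_of_card_le (hP.subset T hT') ?_
    rw [hS, (hP.clique _ hT).card_eq, (hP.clique _ hT').card_eq]
  refine ⟨∅, ?_⟩
  rw [hG, hPS]
  exact .triangle S (hS ▸ (hP.clique _ hT).card_eq)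

theorem CoverOn.exists_ordered [DecidableEq V] {S : Finset V} {G : SimpleGraph V} (d : V → ℕ)
    {P : Finset (Finset V)} (hP : CoverOn S G P) {c : V} (hc : c ∈ S) :
    ∃ y z, {c, y, z} ∈ P ∧ d y ≤ d z ∧ G.Adj c y ∧ G.Adj c z ∧ G.Adj y z := by
  obtain ⟨T, hT, hcT⟩ := hP.exists_mem c hc
  have hcard : (T.erase c).card = 2 := by
    rw [Finset.card_erase_of_mem hcT, (hP.clique T hT).card_eq]
  obtain ⟨y, z, -, hyz⟩ := Finset.card_eq_two.1 hcard
  have hTe : T = {c, y, z} := by rw [← Finset.insert_erase hcT, hyz]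
  subst hTe
  obtain ⟨h1, h2, h3⟩ := isNClique_three.1 (hP.clique _ hT)
  rcases le_total (d y) (d z) with h | h
  · exact ⟨y, z, hT, h, h1, h2, h3⟩
  · exact ⟨z, y, by rwa [Finset.pair_comm], h, h2, h1, h3.symm⟩

theorem Layered.exists_inFamilyE [DecidableEq V] {d : V → ℕ} (S : Finset V) :
    ∀ (G : SimpleGraph V) (P : Finset (Finset V)), Layered S G d → CoverOn S G P →
      ∃ B, InFamilyE S G P B := by
  induction S using Finset.strongInduction with
  | H S ih =>
  intro G P hd hP
  obtain ⟨r, s, hrs, hr, hs, hroot⟩ := hd.exists_root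
  obtain ⟨x, hxS, hmax⟩ := S.exists_max_image d ⟨r, hd.mem_of_adj hrs⟩
  -- Depth 0 holds only two vertices, too few for a cover triangle.
  have hxpos : 0 < d x := by
    by_contra h0
    obtain ⟨T, hT, -⟩ := hP.exists_mem x hxS
    have hsub : T ⊆ {r, s} := fun v hv => by
      have hvS := hP.subset T hT hv
      have := hroot v hvS (by have := hmax v hvS; omega)
      simpa using this
    have := (Finset.card_le_card hsub).trans Finset.card_le_two
    rw [(hP.clique T hT).card_eq] at this
    omega
  obtain ⟨-, b, -, hxb, -, hb, -, -⟩ := hd.exists_parents x hxS hxpos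
  rcases Nat.eq_zero_or_pos (d b) with hb0 | hb0
  · exact hd.inFamilyE_of_depth_eq_one hP hxS (by omega) fun v hv => (hmax v hv).trans (by omega)
  have hmax' : ∀ v ∈ S, d v ≤ d b + 1 := fun v hv => hb ▸ hmax v hv
  obtain ⟨a, c, hda, hdc, hac, hor, nx, nb, hT⟩ :=
    hd.exists_neighbors_of_child hP hb0 hmax' hxb.symm (by omega)
  have hT' : {a, b, x} ∈ P := by
    convert hT using 1
    ext
    simp only [Finset.mem_insert, Finset.mem_singleton]
    tauto
  have hab : G.Adj a b := ((nb a).2 (by simp)).symm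
  have hbc : G.Adj b c := (nb c).2 (by simp)
  have haS := hd.mem_of_adj hab
  have hcS := hd.mem_of_adj' hbc
  have huniq : ∀ T' ∈ P, ∀ v ∈ T', v ∈ ({x, a, b} : Finset V) →
      ∀ u ∈ T', u = x ∨ u = a ∨ u = b := by
    intro T' hT' v hv hv' u hu
    rw [hP.unique _ hT' _ hT v hv hv'] at hu
    simpa using hu
  -- Here `x` is a leaf on `ab`, the vertex `b` has neighbors `a, c, x`, and `xab` is in the cover.
  -- The deeper of `a` and `c` is one level above `b`; the cases differ in which one it is.
  rcases lt_or_ge (d c) (d a) with hlt | hle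
  · by_cases hz : ∃ z, G.Adj a z ∧ d a < d z ∧ z ≠ b ∧ z ≠ x
    · obtain ⟨z, haz, hdz, hzb, hzx⟩ := hz
      have hzS := hd.mem_of_adj' haz
      have hzT : ∀ T' ∈ P, a ∈ T' → z ∉ T' := fun T' hT' ha h => by
        rcases huniq T' hT' a ha (by simp) z h with h | h | h
        · exact hzx h
        · exact haz.ne h.symm
        · exact hzb h
      -- A leaf `z` would force a cover triangle through `a` other than `xab`. So `z` has a child
      -- `w`, with cover triangle `wyz`, and `wyz`, `abx` arise by `𝒪₂` from `yza`.
      by_cases hleaf : ∀ u, G.Adj z u → d u ≤ d z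
      · obtain ⟨p, q, -, -, -, h⟩ := hd.exists_neighbors_of_leaf hzS (by omega) hleaf
        refine (hzT _ (hP.mem_of_neighbors hzS fun u => (h u).1) ?_ (by simp)).elim
        rcases (h a).1 haz.symm with rfl | rfl <;> simp
      · push Not at hleaf
        obtain ⟨w, hzw, hdw⟩ := hleaf
        have hwS := hmax' w (hd.mem_of_adj' hzw)
        have hzb' : d z = d b := by omega
        obtain ⟨y, y', hy, hy', hyy', -, nw, nz, hTw⟩ :=
          hd.exists_neighbors_of_child hP (by omega) (hzb' ▸ hmax') hzw hdw
        have hay' : a = y' := by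
          rcases (nz a).1 haz.symm with rfl | h | rfl
          · exact (hzT _ hTw (by simp) (by simp)).elim
          · exact h
          · omega
        subst hay'
        have hzy : G.Adj z y := (nz y).2 (by simp)
        refine hd.inFamilyE_of_op2 hP ih (v₁ := y) (v₂ := z) (v₃ := a) (v₄ := c) (u₀ := w)
          hzy.symm hyy' haz.symm hac hTw hT' ?_ ?_ ?_ ?_ ?_ ?_ nw nb nx
        · rintro rfl
          omega
        all_goals omega
    -- Now `b` and `x` are the only deeper neighbors of `a`, so `a, b, x` can be removed by undoing
    -- `𝒪₁`.
    · push Not at hz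
      obtain ⟨p, q, hp, hq, hpq, h1, h2, h3⟩ := hd.exists_parents a haS (by omega)
      obtain ⟨e, hae, hec, hde, h3⟩ : ∃ e, G.Adj a e ∧ G.Adj e c ∧ d e < d a ∧
          ∀ u, G.Adj a u → d u ≤ d a → u = e ∨ u = c := by
        rcases h3 c hac hlt.le with rfl | rfl
        · exact ⟨q, hq, hpq.symm, by omega, fun u hu hu' => (h3 u hu hu').symm⟩
        · exact ⟨p, hp, hpq, by omega, h3⟩
      refine hd.inFamilyE_of_op1 hP ih (v₁ := e) (v₂ := c) hec hT' hde hlt hda (by omega)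
        (fun u => ?_) (fun u => ?_) nx
      · constructor
        · intro hu
          rcases le_or_gt (d u) (d a) with h | h
          · have := h3 u hu h
            tauto
          · have := hz u hu h
            tauto
        · rintro (rfl | rfl | rfl | rfl)
          · exact hae
          · exact hac
          · exact hab
          · exact ((nx a).2 (by simp)).symm
      · rw [nb u]
        tauto
  · have hcb : d c + 1 = d b := by omega
    have hcx : c ≠ x := by
      rintro rfl
      omega
    obtain ⟨y, z, hTc, hyz, hcy, hcz, hyz'⟩ := hP.exists_ordered d hcS
    have hcT : ∀ T' ∈ P, c ∈ T' → ∀ v ∈ ({x, a, b} : Finset V), v ∉ T' := by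
      intro T' hT' hc v hv hv'
      rcases huniq T' hT' v hv' hv c hc with h | h | h
      · exact hcx h
      · exact hac.ne h.symm
      · exact hbc.ne h.symm
    have hay : a ≠ y := by
      rintro rfl
      exact hcT _ hTc (by simp) a (by simp) (by simp)
    have haz : a ≠ z := by
      rintro rfl
      exact hcT _ hTc (by simp) a (by simp) (by simp)
    have hzS := hmax' z (hd.mem_of_adj' hcz)
    -- The cover triangle `cyz` of `c` avoids `x, a, b`. If `y` lies below `c`, then `z` is a leaf
    -- child of `y`, and `abx`, `cyz` arise by `𝒪₂` from `abc`.
    rcases lt_or_ge (d c) (d y) with hcy' | hcy'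
    · have hyz2 : d y ≠ d z := fun h => by
        have := hd.depth_eq_zero hyz' h
        omega
      have hyb : d y = d b := by omega
      obtain ⟨p, q, hp, hq, hpq, -, nz, ny, -⟩ :=
        hd.exists_neighbors_of_child hP (by omega) (hyb ▸ hmax') hyz' (by omega)
      have hpc : p = c := by
        rcases (nz c).1 hcz.symm with h | h
        · exact h.symm
        · exact (hcy.ne h).elim
      subst hpc
      exact hd.inFamilyE_of_op2 hP ih (v₁ := a) (v₂ := b) (v₃ := p) (v₄ := q) (u₀ := x)
        hab hac hbc hpq hT hTc hcx (by omega) (by omega) (by omega) (by omega) (by omega)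
        nx ny nz
    -- Otherwise `a` and `y` are the parents of `c`: at depth 0 there would be three distinct
    -- vertices `a`, `y`, `c`, but the root edge has only two.
    · have hcpos : 0 < d c := by
        by_contra h0
        have hy := hroot y (hd.mem_of_adj' hcy) (by omega)
        have ha := hroot a haS (by omega)
        have hc := hroot c hcS (by omega)
        rcases hc with rfl | rfl
        · exact hay ((ha.resolve_left hac.ne).trans (hy.resolve_left hcy.ne').symm)
        · exact hay ((ha.resolve_right hac.ne).trans (hy.resolve_right hcy.ne').symm)
      obtain ⟨p, q, hp, hq, hpq, h1, h2, h3⟩ := hd.exists_parents c hcS hcpos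
      obtain ⟨hay', hdy, h3⟩ : G.Adj a y ∧ d y < d c ∧
          ∀ u, G.Adj c u → d u ≤ d c → u = a ∨ u = y := by
        rcases h3 a hac.symm hle with rfl | rfl <;> rcases h3 y hcy hcy' with rfl | rfl
        · exact (hay rfl).elim
        · exact ⟨hpq, by omega, h3⟩
        · exact ⟨hpq.symm, by omega, fun u hu hu' => (h3 u hu hu').symm⟩
        · exact (hay rfl).elim
      have hdz : d c < d z := by
        by_contra! hz
        rcases h3 z hcz hz with h | h
        · exact haz h.symm
        · exact hyz'.ne h.symm
      -- A child of `z` would share a cover triangle with `z`, hence be one of `c, y, z`, none of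
      -- which is deeper than `z`.
      have hleaf : ∀ u, G.Adj z u → d u ≤ d z := by
        by_contra! h
        obtain ⟨w, hzw, hdw⟩ := h
        have hwS := hmax' w (hd.mem_of_adj' hzw)
        have hzb' : d z = d b := by omega
        obtain ⟨_, _, -, -, -, -, -, -, hTw⟩ :=
          hd.exists_neighbors_of_child hP (by omega) (hzb' ▸ hmax') hzw hdw
        have e := hP.unique _ hTw _ hTc z (by simp) (by simp)
        have hmem : w ∈ ({c, y, z} : Finset V) := by rw [← e]; simp
        simp only [Finset.mem_insert, Finset.mem_singleton] at hmem
        rcases hmem with rfl | rfl | rfl <;> omega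
      obtain ⟨p', q', -, -, -, nz⟩ :=
        hd.exists_neighbors_of_leaf (hd.mem_of_adj' hcz) (by omega) hleaf
      have nz' : ∀ u, G.Adj z u ↔ u = c ∨ u = y := by
        intro u
        rcases (nz c).1 hcz.symm with e1 | e1 <;> rcases (nz y).1 hyz'.symm with e2 | e2
        · exact (hcy.ne (e1.trans e2.symm)).elim
        · rw [nz, e1, e2]
        · rw [nz, e1, e2, or_comm]
        · exact (hcy.ne (e1.trans e2.symm)).elim
      have hTz : {z, c, y} ∈ P := by
        convert hTc using 1
        ext
        simp only [Finset.mem_insert, Finset.mem_singleton]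
        tauto
      -- The triangles `zcy` and `abx` arise from `cya`. Since `b` hangs on the edge `ac`, this is
      -- the case `v₄ = v₁` of `𝒪₂`.
      exact hd.inFamilyE_of_op2 hP ih (v₁ := c) (v₂ := y) (v₃ := a) (v₄ := c) (u₀ := z)
        hcy hac.symm hay'.symm hac hTz hT' haz (by omega) (by omega) (by omega) (by omega)
        (by omega) nz' nb nx

end

end TwoTree

theorem mainTheorem1 {V : Type*} [Fintype V] [DecidableEq V] (G : SimpleGraph V)
    (hG : TwoTree.IsKTree 2 G) (hn : 3 ≤ Fintype.card V) :
    List.TFAE [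
      ∃ P : Set (Finset V), TwoTree.IsPerfectCover G 3 P,
      TwoTree.BelongsToE G,
      TwoTree.IsAlphaExcellent G] := by
  have : Nonempty V := Fintype.card_pos_iff.1 (by omega)
  rw [TwoTree.exists_isPerfectCover_iff]
  tfae_have 1 → 2 := by
    rintro ⟨P, hP⟩
    obtain ⟨d, hd⟩ := TwoTree.IsKTreeOn.exists_layered hG
    obtain ⟨B, h⟩ := hd.exists_inFamilyE _ G P hP
    exact ⟨P, B, h⟩
  tfae_have 2 → 1 := fun ⟨R, _, h⟩ => ⟨R, h.coverOn.2⟩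
  tfae_have 1 → 3 := fun ⟨_, hP⟩ => hP.isAlphaExcellent hG
  tfae_have 3 → 1 := fun h => h.exists_coverOn hG hn
  tfae_finish
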